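/- Let $A\in\mathbb R^{n\times n}$, $C_1,\dots,C_M\in\mathbb R^{p\times n}$, and let $\Phi^w\in\mathbb R^{n\times n}$ and $\Phi^v_1,\dots,\Phi^v_M\in\mathbb R^{p\times p}$ be symmetric positive definite. Consider the system $x(t+1)=Ax(t)+w(t)$, $t=0,1,2,\dots$, observed by $M$ sensors $y_i(t)=C_ix(t)+v_i(t)$, $i=1,\dots,M$, where $x(0)\sim\mathcal N(0,\phi)$, $w(t)\sim\mathcal N(0,\Phi^w)$ and $v_i(t)\sim\mathcal N(0,\Phi^v_i)$ are mutually independent and $\phi$ is positive semidefinite. A schedule is a sequence $\sigma:\{0,1,2,\dots\}\to\{1,\dots,M\}$; under it the measurement at time $t$ is $y(t)=C_{\sigma(t)}x(t)+v_{\sigma(t)}(t)$. Let $\hat x^\sigma(t|t)=\mathbb E[x(t)\mid y(0),\dots,y(t)]$ be the minimum mean-square error estimate, and let $\Sigma^\sigma_t(\phi)$ be the covariance matrix of the prediction error $x(t)-A\hat x^\sigma(t-1|t-1)$ for $t\ge1$, and of $x(0)$ for $t=0$. For $N\ge1$ define the $N$-horizon average-per-stage cost $$\bar J_N(\sigma;\phi)=\frac1N\sum_{t=1}^N\operatorname{tr}\Sigma^\sigma_t(\phi).$$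 Call $\sigma$ feasible for $\phi$ if there is $\beta<\infty$ with $\Sigma^\sigma_t(\phi)\preceq\beta I_n$ for all $t\ge0$, and let $$\bar V^*(\phi)=\inf\Big\{\limsup_{N\to\infty}\bar J_N(\sigma;\phi)\ :\ \sigma\text{ feasible for }\phi\Big\}.$$ A schedule is optimal for $\phi$ if it is feasible for $\phi$ and attains this infimum. Assume that for every positive semidefinite $\phi$ there is a feasible schedule for $\phi$. Let $\phi_0$ be positive semidefinite and let $\sigma^*$ be an optimal schedule for $\phi_0$. Then the sequence $\big(\bar J_N(\sigma^*;\phi_0)\big)_{N\ge1}$ converges, and $$\lim_{N\to\infty}\bar J_N(\sigma^*;\phi_0)=\bar V^*(\phi_0).$$ -/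

import Mathlib

open MeasureTheory ProbabilityTheory Filter Topology

noncomputable section

namespace SensorScheduling

/-- The data of a linear time-invariant Gaussian system with `n`-dimensional state, observed by
`M` linear sensors with `p`-dimensional outputs:
`x (t + 1) = A x t + w t`, `y i t = C i x t + v i t`,
where `w t ∼ N(0, procCov)` and `v i t ∼ N(0, sensCov i)`. -/
structure System (n p M : ℕ) where
  /-- the state matrix -/
  A : Matrix (Fin n) (Fin n) ℝ
  /-- the observation matrix of each sensor -/
  C : Fin M → Matrix (Fin p) (Fin n) ℝ
  /-- the covariance matrix of the process noise -/
  procCov : Matrix (Fin n) (Fin n) ℝ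
  /-- the covariance matrix of the measurement noise of each sensor -/
  sensCov : Fin M → Matrix (Fin p) (Fin p) ℝ

/-- Labels of the independent random inputs of the system: the initial state, the process noise
at each time, and the measurement noise of each sensor at each time. -/
inductive InputIndex (M : ℕ) : Type
  | init : InputIndex M
  | proc (t : ℕ) : InputIndex M
  | sens (i : Fin M) (t : ℕ) : InputIndex M

/-- The dimension of each random input. -/
abbrev inputDim (n p : ℕ) {M : ℕ} : InputIndex M → ℕ
  | .init => n
  | .proc _ => n
  | .sens _ _ => p

/-- The sample space: one vector for each random input. -/
abbrev Sample (n p M : ℕ) : Type :=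
  (k : InputIndex M) → EuclideanSpace ℝ (Fin (inputDim n p k))

/-- An infinite-horizon sensor schedule: the sensor used at each time. -/
abbrev Schedule (M : ℕ) : Type := ℕ → Fin M

namespace System

variable {n p M : ℕ} (S : System n p M)

/-- The covariance matrix of each random input, when the initial state has covariance `φ`. -/
def inputCov (φ : Matrix (Fin n) (Fin n) ℝ) :
    (k : InputIndex M) → Matrix (Fin (inputDim n p k)) (Fin (inputDim n p k)) ℝ
  | .init => φ
  | .proc _ => S.procCov
  | .sens i _ => S.sensCov i

/-- The law of the random inputs: they are mutually independent centred Gaussian vectors. -/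
def law (φ : Matrix (Fin n) (Fin n) ℝ) : Measure (Sample n p M) :=
  Measure.infinitePi fun k => multivariateGaussian 0 (S.inputCov φ k)

/-- The state process: `x 0` is the initial state and `x (t + 1) = A x t + w t`. -/
def state : ℕ → Sample n p M → EuclideanSpace ℝ (Fin n)
  | 0, ω => ω .init
  | t + 1, ω => Matrix.toEuclideanLin S.A (state t ω) + ω (.proc t)

/-- The measurement at time `t` under the schedule `σ`:
`y t = C (σ t) x t + v (σ t) t`. -/
def meas (σ : Schedule M) (t : ℕ) (ω : Sample n p M) : EuclideanSpace ℝ (Fin p) :=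
  Matrix.toEuclideanLin (S.C (σ t)) (S.state t ω) + ω (.sens (σ t) t)

/-- The σ-algebra generated by the measurements `y 0, …, y t`. -/
abbrev measSigma (σ : Schedule M) (t : ℕ) : MeasurableSpace (Sample n p M) :=
  MeasurableSpace.comap (fun ω (s : Fin (t + 1)) => S.meas σ s ω) inferInstance

/-- The minimum mean-square error estimate of `x t` given `y 0, …, y t`, that is, the conditional
expectation, when the initial state has covariance `φ`. -/
def estimate (φ : Matrix (Fin n) (Fin n) ℝ) (σ : Schedule M) (t : ℕ) :
    Sample n p M → EuclideanSpace ℝ (Fin n) :=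
  (S.law φ)[S.state t | S.measSigma σ t]

/-- The one-step prediction error. At time `t + 1` it is `x (t + 1)` minus `A` times the estimate
of `x t` given `y 0, …, y t`; at time `0` there is no measurement yet, the prediction
is the mean `0` of the initial state, and the error is `x 0`. -/
def predError (φ : Matrix (Fin n) (Fin n) ℝ) (σ : Schedule M) :
    ℕ → Sample n p M → EuclideanSpace ℝ (Fin n)
  | 0, ω => S.state 0 ω
  | t + 1, ω => S.state (t + 1) ω - Matrix.toEuclideanLin S.A (S.estimate φ σ t ω)

/-- The covariance matrix of the prediction error at time `t` under the schedule `σ`, when the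
initial state has covariance `φ`. -/
def errorCov (σ : Schedule M) (φ : Matrix (Fin n) (Fin n) ℝ) (t : ℕ) :
    Matrix (Fin n) (Fin n) ℝ :=
  Matrix.of fun i j =>
    cov[fun ω => S.predError φ σ t ω i, fun ω => S.predError φ σ t ω j; S.law φ]

/-- The `N`-horizon average-per-stage cost. -/
def avgCost (σ : Schedule M) (φ : Matrix (Fin n) (Fin n) ℝ) (N : ℕ) : ℝ :=
  (1 / (N : ℝ)) * ∑ t ∈ Finset.Icc 1 N, (S.errorCov σ φ t).trace

/-- The infinite-horizon average-per-stage cost. For a feasible schedule the sequence of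
`N`-horizon costs is bounded, so this is a genuine limit superior. -/
def infCost (σ : Schedule M) (φ : Matrix (Fin n) (Fin n) ℝ) : ℝ :=
  limsup (fun N : ℕ => S.avgCost σ φ N) atTop

/-- The feasible schedules for the initial covariance `φ`: those under which the prediction error
covariance satisfies `errorCov t ⪯ β I` for all `t`, for some real `β`. -/
def feasible (φ : Matrix (Fin n) (Fin n) ℝ) : Set (Schedule M) :=
  {σ | ∃ β : ℝ, ∀ t : ℕ,
    (β • (1 : Matrix (Fin n) (Fin n) ℝ) - S.errorCov σ φ t).PosSemidef}

/-- The optimal infinite-horizon cost for the initial covariance `φ`: the infimum of the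
infinite-horizon costs (which are nonnegative) of the feasible schedules. -/
def optCost (φ : Matrix (Fin n) (Fin n) ℝ) : ℝ :=
  sInf ((fun σ => S.infCost σ φ) '' S.feasible φ)

/-- A schedule is optimal for `φ` if it is feasible for `φ` and achieves the optimal cost. -/
def IsOptimal (σ : Schedule M) (φ : Matrix (Fin n) (Fin n) ℝ) : Prop :=
  σ ∈ S.feasible φ ∧ S.infCost σ φ = S.optCost φ

end System

end SensorScheduling

end

/-! Since `σ` is optimal, the limsup of its average costs is the optimal value, so only the liminf
needs a lower bound. It comes from `exists_optCost_le_avgCost`: for large `N` the first `N`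
decisions of a feasible schedule, repeated periodically, form a feasible schedule whose
infinite-horizon cost is at most the `N`-horizon cost plus `c / N`. Hence `optCost - c / N ≤ avgCost
N`, and letting `N` grow finishes the proof.

The periodic schedule restarts each period from a covariance other than the initial one, and this
effect must cost only `O(1)` per period. Let `P` be the covariances of the original schedule and `Q`
those of the periodic one inside a period. Running the filter for `Q` with the gains of `P` can only
enlarge `Q` (`errorCov_succ_le`), and then both follow the same affine recursion. If `Q ≤ (1 + s)
P`, one step improves `s` to `s η`, because the noise term is not scaled and, `P` being bounded,
process noise is a fixed fraction of `P` (`gainUpdate_le_of_le_smul`). The relative excess therefore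
decays geometrically and has a bounded sum. For large `N` it is at most `1` at the end of a period,
so the next period starts below the same multiple of the identity and the argument repeats.

The costs are defined by conditional expectations, so the recursion must first be derived.
Uncorrelated linear functions of the Gaussian inputs are independent, which identifies the
conditional expectation with the Kalman filter (`estimate_ae_eq`); `errorCov_succ` then gives the
covariance recursion. -/

noncomputable section

namespace SensorScheduling

/-! ### Bilinear calculus of cross-covariance matrices -/

section CrossCov

variable {Ω : Type*} {mΩ : MeasurableSpace Ω} {μ : Measure Ω}
  {ι κ l : Type*}

/-- The cross-covariance matrix of two random vectors. -/
def crossCov (μ : Measure Ω) (X : Ω → EuclideanSpace ℝ ι) (Y : Ω → EuclideanSpace ℝ κ) :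
    Matrix ι κ ℝ :=
  Matrix.of fun i j => cov[fun ω => X ω i, fun ω => Y ω j; μ]

lemma crossCov_transpose (X : Ω → EuclideanSpace ℝ ι) (Y : Ω → EuclideanSpace ℝ κ) :
    (crossCov μ X Y).transpose = crossCov μ Y X := by
  ext i j
  exact covariance_comm _ _

lemma crossCov_congr {X X' : Ω → EuclideanSpace ℝ ι} {Y Y' : Ω → EuclideanSpace ℝ κ}
    (hX : X =ᵐ[μ] X') (hY : Y =ᵐ[μ] Y') : crossCov μ X Y = crossCov μ X' Y' := by
  ext i j
  have hX' : (fun ω => X ω i) =ᵐ[μ] fun ω => X' ω i := hX.mono fun ω h => by simp only [h]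
  have hY' : (fun ω => Y ω j) =ᵐ[μ] fun ω => Y' ω j := hY.mono fun ω h => by simp only [h]
  simp only [crossCov, Matrix.of_apply, covariance, integral_congr_ae hX', integral_congr_ae hY']
  refine integral_congr_ae ?_
  filter_upwards [hX, hY] with ω h1 h2
  rw [h1, h2]

variable [Fintype ι]

lemma memLp_eval {X : Ω → EuclideanSpace ℝ ι} (hX : MemLp X 2 μ) (i : ι) :
    MemLp (fun ω => X ω i) 2 μ :=
  (EuclideanSpace.proj (𝕜 := ℝ) i).comp_memLp' hX

lemma memLp_of_eval {X : Ω → EuclideanSpace ℝ ι} (hX : ∀ i, MemLp (fun ω => X ω i) 2 μ) :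
    MemLp X 2 μ :=
  MemLp.of_eval_piLp hX

lemma memLp_toEuclideanLin [DecidableEq ι] [Fintype κ] {X : Ω → EuclideanSpace ℝ ι} (hX : MemLp X 2 μ)
    (L : Matrix κ ι ℝ) : MemLp (fun ω => Matrix.toEuclideanLin L (X ω)) 2 μ :=
  (LinearMap.toContinuousLinearMap (Matrix.toEuclideanLin L)).comp_memLp' hX

variable [IsProbabilityMeasure μ]

lemma crossCov_add_left [Fintype κ] {X X' : Ω → EuclideanSpace ℝ ι}
    {Y : Ω → EuclideanSpace ℝ κ}
    (hX : MemLp X 2 μ) (hX' : MemLp X' 2 μ) (hY : MemLp Y 2 μ) :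
    crossCov μ (fun ω => X ω + X' ω) Y = crossCov μ X Y + crossCov μ X' Y := by
  ext i j
  exact covariance_add_left (memLp_eval hX i) (memLp_eval hX' i) (memLp_eval hY j)

lemma crossCov_sub_left [Fintype κ] {X X' : Ω → EuclideanSpace ℝ ι} {Y : Ω → EuclideanSpace ℝ κ}
    (hX : MemLp X 2 μ) (hX' : MemLp X' 2 μ) (hY : MemLp Y 2 μ) :
    crossCov μ (fun ω => X ω - X' ω) Y = crossCov μ X Y - crossCov μ X' Y := by
  ext i j
  exact covariance_sub_left (memLp_eval hX i) (memLp_eval hX' i) (memLp_eval hY j)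

lemma crossCov_map_left [DecidableEq ι] [Fintype l] {X : Ω → EuclideanSpace ℝ ι}
    {Y : Ω → EuclideanSpace ℝ l}
    (hX : MemLp X 2 μ) (hY : MemLp Y 2 μ) (L : Matrix κ ι ℝ) :
    crossCov μ (fun ω => Matrix.toEuclideanLin L (X ω)) Y = L * crossCov μ X Y := by
  ext i j
  have h : (fun ω => Matrix.toEuclideanLin L (X ω) i) = fun ω => ∑ k, L i k * X ω k := by
    ext ω
    simp [Matrix.toLpLin_apply, Matrix.mulVec, dotProduct]
  rw [crossCov, Matrix.of_apply, h,
    covariance_fun_sum_left (fun k => (memLp_eval hX k).const_mul _) (memLp_eval hY j)]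
  simp [Matrix.mul_apply, covariance_const_mul_left, crossCov]

lemma crossCov_add_right [Fintype κ] {X X' : Ω → EuclideanSpace ℝ ι} {Y : Ω → EuclideanSpace ℝ κ}
    (hX : MemLp X 2 μ) (hX' : MemLp X' 2 μ) (hY : MemLp Y 2 μ) :
    crossCov μ Y (fun ω => X ω + X' ω) = crossCov μ Y X + crossCov μ Y X' := by
  rw [← crossCov_transpose, crossCov_add_left hX hX' hY, Matrix.transpose_add,
    crossCov_transpose, crossCov_transpose]

lemma crossCov_sub_right [Fintype κ] {X X' : Ω → EuclideanSpace ℝ ι} {Y : Ω → EuclideanSpace ℝ κ}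
    (hX : MemLp X 2 μ) (hX' : MemLp X' 2 μ) (hY : MemLp Y 2 μ) :
    crossCov μ Y (fun ω => X ω - X' ω) = crossCov μ Y X - crossCov μ Y X' := by
  rw [← crossCov_transpose, crossCov_sub_left hX hX' hY, Matrix.transpose_sub,
    crossCov_transpose, crossCov_transpose]

lemma crossCov_map_right [DecidableEq ι] [Fintype l] {X : Ω → EuclideanSpace ℝ ι}
    {Y : Ω → EuclideanSpace ℝ l} (hX : MemLp X 2 μ) (hY : MemLp Y 2 μ) (L : Matrix κ ι ℝ) :
    crossCov μ Y (fun ω => Matrix.toEuclideanLin L (X ω)) = crossCov μ Y X * L.transpose := by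
  rw [← crossCov_transpose, crossCov_map_left hX hY, Matrix.transpose_mul, crossCov_transpose]

/-- The quadratic form at `x` is the variance of the scalar `∑ i, x i * X i`. -/
lemma crossCov_self_posSemidef {X : Ω → EuclideanSpace ℝ ι} (hX : MemLp X 2 μ) :
    (crossCov μ X X).PosSemidef := by
  classical
  refine Matrix.PosSemidef.of_dotProduct_mulVec_nonneg
    (by rw [Matrix.IsHermitian, Matrix.conjTranspose_eq_transpose_of_trivial,
      crossCov_transpose]) fun x => ?_
  have h : star x ⬝ᵥ (crossCov μ X X).mulVec x = Var[fun ω => ∑ i, x i * X ω i; μ] := by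
    rw [← covariance_self (Finset.aemeasurable_fun_sum _ fun i _ =>
        ((memLp_eval hX i).const_mul _).aestronglyMeasurable.aemeasurable),
      covariance_fun_sum_fun_sum (fun k => (memLp_eval hX k).const_mul _)
        (fun k => (memLp_eval hX k).const_mul _)]
    simp only [covariance_const_mul_left, covariance_const_mul_right, dotProduct, Matrix.mulVec,
      Finset.mul_sum, crossCov, Matrix.of_apply, Pi.star_apply, star_trivial]
    exact Finset.sum_congr rfl fun i _ => Finset.sum_congr rfl fun j _ => by ring
  rw [h]
  exact variance_nonneg _ _

end CrossCov

/-! ### Linear functionals of the independent Gaussian inputs -/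

section Inputs

variable {n p M : ℕ} (S : System n p M) {φ : Matrix (Fin n) (Fin n) ℝ}

instance (φ : Matrix (Fin n) (Fin n) ℝ) : IsProbabilityMeasure (S.law φ) :=
  inferInstanceAs (IsProbabilityMeasure (Measure.infinitePi _))

/-- The linear functionals of the random inputs with labels in `s`. -/
def inputSpan (n p : ℕ) (s : Set (InputIndex M)) : Submodule ℝ (Sample n p M → ℝ) :=
  Submodule.span ℝ {f | ∃ k ∈ s, ∃ i, f = fun ω => ω k i}

lemma inputSpan_mono {s t : Set (InputIndex M)} (h : s ⊆ t) :
    inputSpan n p s ≤ inputSpan n p t :=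
  Submodule.span_mono fun _ ⟨k, hk, i, hf⟩ => ⟨k, h hk, i, hf⟩

lemma coord_mem_inputSpan {s : Set (InputIndex M)} {k : InputIndex M} (hk : k ∈ s)
    (i : Fin (inputDim n p k)) : (fun ω : Sample n p M => ω k i) ∈ inputSpan n p s :=
  Submodule.subset_span ⟨k, hk, i, rfl⟩

lemma measurePreserving_input (φ : Matrix (Fin n) (Fin n) ℝ) (k : InputIndex M) :
    MeasurePreserving (fun ω : Sample n p M => ω k) (S.law φ)
      (multivariateGaussian 0 (S.inputCov φ k)) :=
  measurePreserving_eval_infinitePi _ k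

lemma iIndepFun_input (φ : Matrix (Fin n) (Fin n) ℝ) :
    iIndepFun (fun (k : InputIndex M) (ω : Sample n p M) => ω k) (S.law φ) := by
  rw [iIndepFun_iff_map_fun_eq_infinitePi_map (by fun_prop)]
  simp only [(measurePreserving_input S φ _).map_eq]
  exact Measure.map_id

/-- Finitely many coordinates involve only finitely many input vectors, and independent Gaussian
vectors are jointly Gaussian. -/
lemma isGaussianProcess_input (φ : Matrix (Fin n) (Fin n) ℝ) :
    IsGaussianProcess (fun (q : Σ k : InputIndex M, Fin (inputDim n p k))
      (ω : Sample n p M) => ω q.1 q.2) (S.law φ) := by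
  classical
  refine ⟨fun I => ?_⟩
  let J : Finset (InputIndex M) := I.image Sigma.fst
  have hJ : HasGaussianLaw (fun (ω : Sample n p M) (k : J) => ω k) (S.law φ) := by
    refine iIndepFun.hasGaussianLaw (X := fun (k : J) (ω : Sample n p M) => ω k) (fun k => ?_)
      ((iIndepFun_input S φ).precomp Subtype.val_injective)
    exact HasLaw.hasGaussianLaw (μ := multivariateGaussian 0 (S.inputCov φ k))
      (measurePreserving_input S φ k).hasLaw
  let L : ((k : J) → EuclideanSpace ℝ (Fin (inputDim n p (k : InputIndex M)))) →L[ℝ] (I → ℝ) :=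
    ContinuousLinearMap.pi fun q =>
      (EuclideanSpace.proj (𝕜 := ℝ) q.1.2).comp
        (ContinuousLinearMap.proj (R := ℝ)
          (φ := fun k : J => EuclideanSpace ℝ (Fin (inputDim n p (k : InputIndex M))))
          ⟨q.1.1, Finset.mem_image_of_mem _ q.2⟩)
  exact hJ.map L

/-- Each `X t` is a finite linear combination of coordinates, and joint Gaussianity survives linear
maps. Square integrability, and independence from vanishing covariance, both rest on this. -/
lemma isGaussianProcess_of_mem_inputSpan {T : Type*} {X : T → Sample n p M → ℝ}
    (hX : ∀ t, X t ∈ inputSpan n p Set.univ) (φ : Matrix (Fin n) (Fin n) ℝ) :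
    IsGaussianProcess X (S.law φ) := by
  refine IsGaussianProcess.of_isGaussianProcess (isGaussianProcess_input S φ) fun t => ?_
  have hr : {f | ∃ k ∈ (Set.univ : Set (InputIndex M)), ∃ i, f = fun ω : Sample n p M => ω k i}
      = Set.range fun (q : Σ k : InputIndex M, Fin (inputDim n p k)) (ω : Sample n p M) =>
        ω q.1 q.2 := by
    ext f
    simp [Sigma.exists, eq_comm]
  have h := hX t
  rw [inputSpan, hr, Finsupp.mem_span_range_iff_exists_finsupp] at h
  obtain ⟨c, hc⟩ := h
  refine ⟨c.support, ∑ q : c.support, c q • ContinuousLinearMap.proj q, fun ω => ?_⟩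
  rw [← hc, Finsupp.sum, Finset.sum_apply, ← Finset.sum_coe_sort]
  simp [Finset.restrict]

lemma memLp_of_mem_inputSpan {f : Sample n p M → ℝ} {s : Set (InputIndex M)}
    (hf : f ∈ inputSpan n p s) : MemLp f 2 (S.law φ) :=
  ((isGaussianProcess_of_mem_inputSpan S (X := fun _ : Unit => f)
    (fun _ => inputSpan_mono (Set.subset_univ _) hf) φ).hasGaussianLaw_eval ()).memLp_two

lemma integral_eq_zero_of_mem_inputSpan {f : Sample n p M → ℝ} {s : Set (InputIndex M)}
    (hf : f ∈ inputSpan n p s) : ∫ ω, f ω ∂(S.law φ) = 0 := by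
  induction hf using Submodule.span_induction with
  | mem f hf =>
    obtain ⟨k, -, i, rfl⟩ := hf
    have h := (measurePreserving_input S φ k).map_eq
    have : ∫ x, x i ∂((S.law φ).map fun ω => ω k) = 0 := by
      rw [h]
      have := (EuclideanSpace.proj (𝕜 := ℝ) i).integral_comp_id_comm
        (μ := multivariateGaussian 0 (S.inputCov φ k)) IsGaussian.integrable_id
      simpa using this
    rwa [integral_map (measurePreserving_input S φ k).measurable.aemeasurable (by fun_prop)] at this
  | zero => simp
  | add f g hf hg h1 h2 =>
    simp only [Pi.add_apply]
    rw [integral_add ((memLp_of_mem_inputSpan S hf).integrable (by norm_num))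
      ((memLp_of_mem_inputSpan S hg).integrable (by norm_num)), h1, h2, add_zero]
  | smul c f hf h => simp [integral_const_mul, h]

/-- By bilinearity it suffices to treat single coordinates, which belong to distinct, hence
independent, inputs. -/
lemma covariance_eq_zero_of_disjoint {f g : Sample n p M → ℝ} {s t : Set (InputIndex M)}
    (hst : Disjoint s t) (hf : f ∈ inputSpan n p s) (hg : g ∈ inputSpan n p t) :
    cov[f, g; S.law φ] = 0 := by
  induction hf using Submodule.span_induction with
  | mem f hf =>
    obtain ⟨k, hk, i, rfl⟩ := hf
    induction hg using Submodule.span_induction with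
    | mem g hg =>
      obtain ⟨k', hk', j, rfl⟩ := hg
      have hne : k ≠ k' := fun h => Set.disjoint_left.1 hst hk (h ▸ hk')
      refine IndepFun.covariance_eq_zero
        (((iIndepFun_input S φ).indepFun hne).comp
          (φ := fun x : EuclideanSpace ℝ (Fin (inputDim n p k)) => x i)
          (ψ := fun x : EuclideanSpace ℝ (Fin (inputDim n p k')) => x j)
          (by fun_prop) (by fun_prop))
        (memLp_of_mem_inputSpan S (coord_mem_inputSpan hk i))
        (memLp_of_mem_inputSpan S (coord_mem_inputSpan hk' j))
    | zero => exact covariance_zero_right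
    | add g g' hg hg' h1 h2 =>
      rw [covariance_add_right (memLp_of_mem_inputSpan S (coord_mem_inputSpan hk i))
        (memLp_of_mem_inputSpan S hg) (memLp_of_mem_inputSpan S hg'), h1, h2, add_zero]
    | smul c g hg h => rw [covariance_smul_right, h, mul_zero]
  | zero => exact covariance_zero_left
  | add f f' hf hf' h1 h2 =>
    rw [covariance_add_left (memLp_of_mem_inputSpan S hf) (memLp_of_mem_inputSpan S hf')
      (memLp_of_mem_inputSpan S hg), h1, h2, add_zero]
  | smul c f hf h => rw [covariance_smul_left, h, mul_zero]

/-- The random vectors whose coordinates are linear functionals of the inputs with labels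
in `s`. -/
def IsInputLinear {a : ℕ} (s : Set (InputIndex M))
    (X : Sample n p M → EuclideanSpace ℝ (Fin a)) : Prop :=
  ∀ i, (fun ω => X ω i) ∈ inputSpan n p s

namespace IsInputLinear

variable {a b : ℕ} {s t : Set (InputIndex M)}
  {X X' : Sample n p M → EuclideanSpace ℝ (Fin a)} {Y : Sample n p M → EuclideanSpace ℝ (Fin b)}

lemma mono (hst : s ⊆ t) (hX : IsInputLinear s X) : IsInputLinear t X :=
  fun i => inputSpan_mono hst (hX i)

lemma zero : IsInputLinear s (fun _ : Sample n p M => (0 : EuclideanSpace ℝ (Fin a))) :=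
  fun _ => Submodule.zero_mem _

lemma add (hX : IsInputLinear s X) (hX' : IsInputLinear s X') :
    IsInputLinear s (fun ω => X ω + X' ω) :=
  fun i => Submodule.add_mem _ (hX i) (hX' i)

lemma sub (hX : IsInputLinear s X) (hX' : IsInputLinear s X') :
    IsInputLinear s (fun ω => X ω - X' ω) :=
  fun i => Submodule.sub_mem _ (hX i) (hX' i)

lemma map (hX : IsInputLinear s X) (L : Matrix (Fin b) (Fin a) ℝ) :
    IsInputLinear s (fun ω => Matrix.toEuclideanLin L (X ω)) := by
  intro i
  have h : (fun ω => Matrix.toEuclideanLin L (X ω) i) = ∑ k, L i k • fun ω => X ω k := by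
    ext ω
    simp [Matrix.toLpLin_apply, Matrix.mulVec, dotProduct]
  rw [h]
  exact Submodule.sum_mem _ fun k _ => Submodule.smul_mem _ _ (hX k)

lemma memLp (hX : IsInputLinear s X) : MemLp X 2 (S.law φ) :=
  memLp_of_eval fun i => memLp_of_mem_inputSpan S (hX i)

lemma crossCov_eq_zero (hst : Disjoint s t) (hX : IsInputLinear s X) (hY : IsInputLinear t Y) :
    crossCov (S.law φ) X Y = 0 := by
  ext i j
  exact covariance_eq_zero_of_disjoint S hst (hX i) (hY j)

lemma integral_eq_zero (hX : IsInputLinear s X) : ∫ ω, X ω ∂(S.law φ) = 0 := by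
  ext i
  have := (EuclideanSpace.proj (𝕜 := ℝ) i).integral_comp_comm
    ((hX.memLp S (φ := φ)).integrable (by norm_num))
  rw [PiLp.zero_apply, ← integral_eq_zero_of_mem_inputSpan S (φ := φ) (hX i)]
  exact this.symm

/-- Uncorrelated linear functions of the Gaussian inputs are independent. -/
lemma indepFun {T : Type*} [Finite T] {Z : T → Sample n p M → EuclideanSpace ℝ (Fin b)}
    (hX : IsInputLinear Set.univ X) (hZ : ∀ t, IsInputLinear Set.univ (Z t))
    (h : ∀ t, crossCov (S.law φ) X (Z t) = 0) :
    IndepFun X (fun ω t => Z t ω) (S.law φ) := by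
  have key := IsGaussianProcess.indepFun_of_covariance_eq_zero (P := S.law φ)
    (X := fun (i : Fin a) ω => X ω i) (Y := fun (q : T × Fin b) ω => Z q.1 ω q.2)
    (isGaussianProcess_of_mem_inputSpan S
      (fun q => by rcases q with i | q; exacts [hX i, hZ q.1 q.2]) φ)
    (fun i => (memLp_of_mem_inputSpan S (hX i)).aestronglyMeasurable.aemeasurable)
    (fun q => (memLp_of_mem_inputSpan S (hZ q.1 q.2)).aestronglyMeasurable.aemeasurable)
    (fun i q => congrFun (congrFun (h q.1) i) q.2)
  exact key.comp (φ := fun x => WithLp.toLp 2 x)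
    (ψ := fun (y : T × Fin b → ℝ) (t : T) => WithLp.toLp 2 fun j => y (t, j))
    (by fun_prop) (by fun_prop)

end IsInputLinear

lemma isInputLinear_input {s : Set (InputIndex M)} {k : InputIndex M} (hk : k ∈ s) :
    IsInputLinear s (fun ω : Sample n p M => ω k) :=
  fun i => coord_mem_inputSpan hk i

lemma crossCov_input (k : InputIndex M) (hk : (S.inputCov φ k).PosSemidef) :
    crossCov (S.law φ) (fun ω => ω k) (fun ω => ω k) = S.inputCov φ k := by
  ext i j
  have h := (measurePreserving_input S φ k).map_eq
  rw [← covariance_eval_multivariateGaussian (μ := 0) hk i j, ← h,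
    covariance_map_fun (by fun_prop) (by fun_prop)
      (measurePreserving_input S φ k).measurable.aemeasurable]
  rfl

end Inputs

/-! ### The Kalman filter and the covariance recursion -/

section Kalman

variable {n p M : ℕ} (S : System n p M) {φ : Matrix (Fin n) (Fin n) ℝ} {σ : Schedule M}

/-- The labels of the inputs that enter the system before the measurement at time `t`, together
with the initial state. -/
def inputsBefore (M t : ℕ) : Set (InputIndex M)
  | .init => True
  | .proc s => s < t
  | .sens _ s => s < t

lemma inputsBefore_mono {s t : ℕ} (h : s ≤ t) : inputsBefore M s ⊆ inputsBefore M t := by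
  rintro (_ | r | ⟨i, r⟩) hr
  exacts [trivial, lt_of_lt_of_le hr h, lt_of_lt_of_le hr h]

lemma proc_mem_inputsBefore (t : ℕ) : InputIndex.proc t ∈ inputsBefore M (t + 1) :=
  Nat.lt_succ_self t

lemma sens_mem_inputsBefore (i : Fin M) (t : ℕ) : InputIndex.sens i t ∈ inputsBefore M (t + 1) :=
  Nat.lt_succ_self t

lemma disjoint_inputsBefore_proc (t : ℕ) : Disjoint (inputsBefore M t) {InputIndex.proc t} :=
  Set.disjoint_singleton_right.2 fun h => lt_irrefl t h

lemma disjoint_inputsBefore_sens (i : Fin M) (t : ℕ) :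
    Disjoint (inputsBefore M t) {InputIndex.sens i t} :=
  Set.disjoint_singleton_right.2 fun h => lt_irrefl t h

namespace System

/-- The Kalman gain at time `t`. -/
def kalmanGain (φ : Matrix (Fin n) (Fin n) ℝ) (σ : Schedule M) (t : ℕ) :
    Matrix (Fin n) (Fin p) ℝ :=
  S.errorCov σ φ t * (S.C (σ t)).transpose *
    (S.C (σ t) * S.errorCov σ φ t * (S.C (σ t)).transpose + S.sensCov (σ t))⁻¹

/-- The measurement update of the Kalman filter. -/
def measUpdate (φ : Matrix (Fin n) (Fin n) ℝ) (σ : Schedule M) (t : ℕ)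
    (X : Sample n p M → EuclideanSpace ℝ (Fin n)) (ω : Sample n p M) :
    EuclideanSpace ℝ (Fin n) :=
  X ω + Matrix.toEuclideanLin (S.kalmanGain φ σ t)
    (S.meas σ t ω - Matrix.toEuclideanLin (S.C (σ t)) (X ω))

/-- The one-step prediction of the Kalman filter. -/
def kalmanPred (φ : Matrix (Fin n) (Fin n) ℝ) (σ : Schedule M) :
    ℕ → Sample n p M → EuclideanSpace ℝ (Fin n)
  | 0, _ => 0
  | t + 1, ω => Matrix.toEuclideanLin S.A (S.measUpdate φ σ t (kalmanPred φ σ t) ω)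

/-- The filtered estimate of the Kalman filter. -/
def kalmanFilt (φ : Matrix (Fin n) (Fin n) ℝ) (σ : Schedule M) (t : ℕ) :
    Sample n p M → EuclideanSpace ℝ (Fin n) :=
  S.measUpdate φ σ t (S.kalmanPred φ σ t)

/-- The prediction error of the Kalman filter. -/
def kalmanErr (φ : Matrix (Fin n) (Fin n) ℝ) (σ : Schedule M) (t : ℕ) (ω : Sample n p M) :
    EuclideanSpace ℝ (Fin n) :=
  S.state t ω - S.kalmanPred φ σ t ω

/-- The covariance of the one-step prediction error of a linear predictor with gain `K` based on
sensor `i`, when the current error has covariance `P`. -/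
def gainUpdate (i : Fin M) (K : Matrix (Fin n) (Fin p) ℝ) (P : Matrix (Fin n) (Fin n) ℝ) :
    Matrix (Fin n) (Fin n) ℝ :=
  (S.A - K * S.C i) * P * (S.A - K * S.C i).transpose + S.procCov
    + K * S.sensCov i * K.transpose

lemma isInputLinear_state (t : ℕ) : IsInputLinear (inputsBefore M t) (S.state t) := by
  induction t with
  | zero => exact isInputLinear_input (k := .init) trivial
  | succ t ih =>
    exact ((ih.mono (inputsBefore_mono t.le_succ)).map S.A).add
      (isInputLinear_input (k := .proc t) (proc_mem_inputsBefore t))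

/-- Sharper than `isInputLinear_meas`: the measurement at time `t` does not involve the process
noise at time `t`, which is needed for that noise to be uncorrelated with it. -/
lemma isInputLinear_meas_union (σ : Schedule M) (t : ℕ) :
    IsInputLinear (inputsBefore M t ∪ {InputIndex.sens (σ t) t}) (S.meas σ t) :=
  (((S.isInputLinear_state t).mono Set.subset_union_left).map _).add
    (isInputLinear_input (k := .sens (σ t) t) (Set.mem_union_right _ rfl))

lemma isInputLinear_meas (σ : Schedule M) (t : ℕ) :
    IsInputLinear (inputsBefore M (t + 1)) (S.meas σ t) :=
  (S.isInputLinear_meas_union σ t).mono (Set.union_subset (inputsBefore_mono t.le_succ)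
    (Set.singleton_subset_iff.2 (sens_mem_inputsBefore _ t)))

lemma isInputLinear_measUpdate {t : ℕ} {X : Sample n p M → EuclideanSpace ℝ (Fin n)}
    (hX : IsInputLinear (inputsBefore M t) X) :
    IsInputLinear (inputsBefore M (t + 1)) (S.measUpdate φ σ t X) :=
  have hX' := hX.mono (inputsBefore_mono t.le_succ)
  hX'.add (((S.isInputLinear_meas σ t).sub (hX'.map _)).map _)

lemma isInputLinear_kalmanPred (φ : Matrix (Fin n) (Fin n) ℝ) (σ : Schedule M) (t : ℕ) :
    IsInputLinear (inputsBefore M t) (S.kalmanPred φ σ t) := by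
  induction t with
  | zero => exact IsInputLinear.zero
  | succ t ih => exact (S.isInputLinear_measUpdate ih).map S.A

lemma isInputLinear_kalmanFilt (φ : Matrix (Fin n) (Fin n) ℝ) (σ : Schedule M) (t : ℕ) :
    IsInputLinear (inputsBefore M (t + 1)) (S.kalmanFilt φ σ t) :=
  S.isInputLinear_measUpdate (S.isInputLinear_kalmanPred φ σ t)

lemma isInputLinear_kalmanErr (φ : Matrix (Fin n) (Fin n) ℝ) (σ : Schedule M) (t : ℕ) :
    IsInputLinear (inputsBefore M t) (S.kalmanErr φ σ t) :=
  (S.isInputLinear_state t).sub (S.isInputLinear_kalmanPred φ σ t)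

lemma state_sub_kalmanFilt (φ : Matrix (Fin n) (Fin n) ℝ) (σ : Schedule M) (t : ℕ)
    (ω : Sample n p M) :
    S.state t ω - S.kalmanFilt φ σ t ω = S.kalmanErr φ σ t ω
      - Matrix.toEuclideanLin (S.kalmanGain φ σ t)
        (Matrix.toEuclideanLin (S.C (σ t)) (S.kalmanErr φ σ t ω) + ω (.sens (σ t) t)) := by
  simp only [kalmanFilt, measUpdate, kalmanErr, meas, map_sub, map_add]
  abel

lemma kalmanErr_succ (φ : Matrix (Fin n) (Fin n) ℝ) (σ : Schedule M) (t : ℕ) (ω : Sample n p M) :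
    S.kalmanErr φ σ (t + 1) ω =
      Matrix.toEuclideanLin S.A (S.state t ω - S.kalmanFilt φ σ t ω) + ω (.proc t) := by
  simp only [kalmanFilt, kalmanErr, state, kalmanPred, map_sub]
  abel

/-- The measurement splits into the innovation and a linear function of the prediction. -/
lemma meas_eq (φ : Matrix (Fin n) (Fin n) ℝ) (σ : Schedule M) (t : ℕ) (ω : Sample n p M) :
    S.meas σ t ω = (Matrix.toEuclideanLin (S.C (σ t)) (S.kalmanErr φ σ t ω)
      + ω (.sens (σ t) t)) + Matrix.toEuclideanLin (S.C (σ t)) (S.kalmanPred φ σ t ω) := by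
  simp only [kalmanErr, meas, map_sub]
  abel

lemma measurable_meas (σ : Schedule M) {s t : ℕ} (h : s ≤ t) :
    Measurable[S.measSigma σ t] (S.meas σ s) := by
  have h1 : Measurable[S.measSigma σ t] fun ω (r : Fin (t + 1)) => S.meas σ r ω :=
    comap_measurable _
  exact (measurable_pi_apply (⟨s, Nat.lt_succ_of_le h⟩ : Fin (t + 1))).comp h1

lemma measurable_kalmanPred (φ : Matrix (Fin n) (Fin n) ℝ) (σ : Schedule M) {s t : ℕ}
    (h : s ≤ t + 1) : Measurable[S.measSigma σ t] (S.kalmanPred φ σ s) := by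
  induction s with
  | zero => exact measurable_const
  | succ s ih =>
    have h1 := ih (by lia)
    have h2 := S.measurable_meas σ (s := s) (t := t) (by lia)
    have hl : ∀ {a b : ℕ} (L : Matrix (Fin a) (Fin b) ℝ), Measurable (Matrix.toEuclideanLin L) :=
      fun L => (LinearMap.continuous_of_finiteDimensional _).measurable
    exact (hl S.A).comp (h1.add ((hl _).comp (h2.sub ((hl _).comp h1))))

lemma measurable_kalmanFilt (φ : Matrix (Fin n) (Fin n) ℝ) (σ : Schedule M) (t : ℕ) :
    Measurable[S.measSigma σ t] (S.kalmanFilt φ σ t) := by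
  have h1 := S.measurable_kalmanPred φ σ (t := t) t.le_succ
  have h2 := S.measurable_meas σ (le_refl t)
  have hl : ∀ {a b : ℕ} (L : Matrix (Fin a) (Fin b) ℝ), Measurable (Matrix.toEuclideanLin L) :=
    fun L => (LinearMap.continuous_of_finiteDimensional _).measurable
  exact h1.add ((hl _).comp (h2.sub ((hl _).comp h1)))

lemma measurable_state (t : ℕ) : Measurable (S.state t) := by
  have hl : Measurable (Matrix.toEuclideanLin S.A) :=
    (LinearMap.continuous_of_finiteDimensional _).measurable
  induction t with
  | zero => exact measurable_pi_apply _
  | succ t ih => exact (hl.comp ih).add (measurable_pi_apply _)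

lemma measSigma_le (σ : Schedule M) (t : ℕ) :
    S.measSigma σ t ≤ (inferInstance : MeasurableSpace (Sample n p M)) := by
  refine Measurable.comap_le (measurable_pi_lambda _ fun s => ?_)
  have hl : Measurable (Matrix.toEuclideanLin (S.C (σ s))) :=
    (LinearMap.continuous_of_finiteDimensional _).measurable
  exact (hl.comp (S.measurable_state s)).add (measurable_pi_apply _)

/-- A random vector uncorrelated with the measurements before time `t` is uncorrelated with the
prediction at time `t`. -/
lemma crossCov_kalmanPred_eq_zero {Z : Sample n p M → EuclideanSpace ℝ (Fin n)}
    (hZ : MemLp Z 2 (S.law φ)) {t : ℕ}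
    (h : ∀ s < t, crossCov (S.law φ) Z (S.meas σ s) = 0) :
    crossCov (S.law φ) Z (S.kalmanPred φ σ t) = 0 := by
  induction t with
  | zero =>
    ext i j
    exact covariance_zero_right
  | succ t ih =>
    have h1 : MemLp (S.kalmanPred φ σ t) 2 (S.law φ) :=
      (S.isInputLinear_kalmanPred φ σ t).memLp S
    have h2 : MemLp (S.meas σ t) 2 (S.law φ) := (S.isInputLinear_meas σ t).memLp S
    have h3 := memLp_toEuclideanLin h1 (S.C (σ t))
    have h4 : MemLp (fun ω => S.meas σ t ω -
      Matrix.toEuclideanLin (S.C (σ t)) (S.kalmanPred φ σ t ω)) 2 (S.law φ) := h2.sub h3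
    have h5 : MemLp (S.measUpdate φ σ t (S.kalmanPred φ σ t)) 2 (S.law φ) :=
      h1.add (memLp_toEuclideanLin h4 _)
    have h0 := ih fun s hs => h s (by lia)
    simp only [kalmanPred]
    rw [crossCov_map_right h5 hZ, show S.measUpdate φ σ t (S.kalmanPred φ σ t) = fun ω =>
      S.kalmanPred φ σ t ω + Matrix.toEuclideanLin (S.kalmanGain φ σ t) (S.meas σ t ω -
        Matrix.toEuclideanLin (S.C (σ t)) (S.kalmanPred φ σ t ω)) from rfl,
      crossCov_add_right h1 (memLp_toEuclideanLin h4 _) hZ, crossCov_map_right h4 hZ,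
      crossCov_sub_right h2 h3 hZ, crossCov_map_right h1 hZ, h0, h t t.lt_succ_self]
    simp

lemma posDef_innovationCov (hsens : ∀ i, (S.sensCov i).PosDef) (i : Fin M)
    {P : Matrix (Fin n) (Fin n) ℝ} (hP : P.PosSemidef) :
    (S.C i * P * (S.C i).transpose + S.sensCov i).PosDef := by
  have := hP.mul_mul_conjTranspose_same (S.C i)
  rw [Matrix.conjTranspose_eq_transpose_of_trivial] at this
  exact Matrix.PosDef.posSemidef_add this (hsens i)

/-! ### Orthogonality of errors and measurements, and optimality of the gain -/

section Moments

variable {t : ℕ}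

lemma memLp_sens (i : Fin M) (t : ℕ) :
    MemLp (fun ω : Sample n p M => (ω (.sens i t) : EuclideanSpace ℝ (Fin p))) 2 (S.law φ) :=
  (isInputLinear_input (k := .sens i t) (Set.mem_univ _)).memLp S

lemma memLp_proc (t : ℕ) :
    MemLp (fun ω : Sample n p M => (ω (.proc t) : EuclideanSpace ℝ (Fin n))) 2 (S.law φ) :=
  (isInputLinear_input (k := .proc t) (Set.mem_univ _)).memLp S

lemma crossCov_sens_left {a : ℕ} {X : Sample n p M → EuclideanSpace ℝ (Fin a)}
    (hX : IsInputLinear (inputsBefore M t) X) (i : Fin M) :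
    crossCov (S.law φ) (fun ω => (ω (.sens i t) : EuclideanSpace ℝ (Fin p))) X = 0 :=
  IsInputLinear.crossCov_eq_zero S (disjoint_inputsBefore_sens i t).symm
    (isInputLinear_input (k := .sens i t) rfl) hX

lemma crossCov_sens_right {a : ℕ} {X : Sample n p M → EuclideanSpace ℝ (Fin a)}
    (hX : IsInputLinear (inputsBefore M t) X) (i : Fin M) :
    crossCov (S.law φ) X (fun ω => (ω (.sens i t) : EuclideanSpace ℝ (Fin p))) = 0 := by
  rw [← crossCov_transpose, crossCov_sens_left S hX, Matrix.transpose_zero]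

lemma crossCov_proc_left {a : ℕ} {X : Sample n p M → EuclideanSpace ℝ (Fin a)}
    {s : Set (InputIndex M)} (hs : InputIndex.proc t ∉ s) (hX : IsInputLinear s X) :
    crossCov (S.law φ) (fun ω => (ω (.proc t) : EuclideanSpace ℝ (Fin n))) X = 0 :=
  IsInputLinear.crossCov_eq_zero S (Set.disjoint_singleton_left.2 hs)
    (isInputLinear_input (k := .proc t) rfl) hX

lemma crossCov_sens (hsens : ∀ i, (S.sensCov i).PosDef) (i : Fin M) (t : ℕ) :
    crossCov (S.law φ) (fun ω => (ω (.sens i t) : EuclideanSpace ℝ (Fin p)))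
      (fun ω => (ω (.sens i t) : EuclideanSpace ℝ (Fin p))) = S.sensCov i :=
  crossCov_input S (.sens i t) (hsens i).posSemidef

lemma crossCov_proc (hproc : S.procCov.PosDef) (t : ℕ) :
    crossCov (S.law φ) (fun ω => (ω (.proc t) : EuclideanSpace ℝ (Fin n)))
      (fun ω => (ω (.proc t) : EuclideanSpace ℝ (Fin n))) = S.procCov :=
  crossCov_input S (.proc t) hproc.posSemidef

/-- The cross-covariance of the filtering error with any random vector. -/
lemma crossCov_filtErr {b : ℕ} {Z : Sample n p M → EuclideanSpace ℝ (Fin b)}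
    (hZ : MemLp Z 2 (S.law φ)) :
    crossCov (S.law φ) (fun ω => S.state t ω - S.kalmanFilt φ σ t ω) Z =
      crossCov (S.law φ) (S.kalmanErr φ σ t) Z - S.kalmanGain φ σ t *
        (S.C (σ t) * crossCov (S.law φ) (S.kalmanErr φ σ t) Z +
          crossCov (S.law φ) (fun ω => (ω (.sens (σ t) t) : EuclideanSpace ℝ (Fin p))) Z) := by
  have he : MemLp (S.kalmanErr φ σ t) 2 (S.law φ) := (S.isInputLinear_kalmanErr φ σ t).memLp S
  have hv := S.memLp_sens (φ := φ) (σ t) t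
  have hC := memLp_toEuclideanLin he (S.C (σ t))
  have hCv : MemLp (fun ω => Matrix.toEuclideanLin (S.C (σ t)) (S.kalmanErr φ σ t ω) +
    (ω (.sens (σ t) t) : EuclideanSpace ℝ (Fin p))) 2 (S.law φ) := hC.add hv
  rw [funext fun ω => S.state_sub_kalmanFilt φ σ t ω,
    crossCov_sub_left he (memLp_toEuclideanLin hCv _) hZ, crossCov_map_left hCv hZ]
  rw [crossCov_add_left hC hv hZ, crossCov_map_left he hZ]

/-- The filtering error is uncorrelated with the measurements, provided that the prediction error
has the covariance used in the gain and is uncorrelated with the earlier measurements. -/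
lemma crossCov_filtErr_meas (hsens : ∀ i, (S.sensCov i).PosDef)
    (hP : crossCov (S.law φ) (S.kalmanErr φ σ t) (S.kalmanErr φ σ t) = S.errorCov σ φ t)
    (horth : ∀ s < t, crossCov (S.law φ) (S.kalmanErr φ σ t) (S.meas σ s) = 0) :
    ∀ s ≤ t, crossCov (S.law φ) (fun ω => S.state t ω - S.kalmanFilt φ σ t ω)
      (S.meas σ s) = 0 := by
  have he : MemLp (S.kalmanErr φ σ t) 2 (S.law φ) := (S.isInputLinear_kalmanErr φ σ t).memLp S
  have hpast : ∀ s < t, crossCov (S.law φ) (fun ω => S.state t ω - S.kalmanFilt φ σ t ω)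
      (S.meas σ s) = 0 := fun s hs => by
    have hm := (S.isInputLinear_meas σ s).mono (inputsBefore_mono (M := M) hs)
    rw [crossCov_filtErr S (hm.memLp S), horth s hs, crossCov_sens_left S hm]
    simp
  intro s hs
  rcases hs.lt_or_eq with hs | rfl
  · exact hpast s hs
  have hv := S.memLp_sens (φ := φ) (σ s) s
  have hC := memLp_toEuclideanLin he (S.C (σ s))
  have hCv : MemLp (fun ω => Matrix.toEuclideanLin (S.C (σ s)) (S.kalmanErr φ σ s ω) +
    (ω (.sens (σ s) s) : EuclideanSpace ℝ (Fin p))) 2 (S.law φ) := hC.add hv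
  have hp : MemLp (S.kalmanPred φ σ s) 2 (S.law φ) := (S.isInputLinear_kalmanPred φ σ s).memLp S
  have hf : MemLp (fun ω => S.state s ω - S.kalmanFilt φ σ s ω) 2 (S.law φ) :=
    (((S.isInputLinear_state s).mono (inputsBefore_mono s.le_succ)).sub
      (S.isInputLinear_kalmanFilt φ σ s)).memLp S
  -- For the current measurement, the prediction part contributes nothing because it depends
  -- linearly on earlier measurements; only the innovation remains.
  rw [funext fun ω => S.meas_eq φ σ s ω, crossCov_add_right hCv (memLp_toEuclideanLin hp _) hf,
    crossCov_map_right hp hf, crossCov_kalmanPred_eq_zero S hf hpast, Matrix.zero_mul, add_zero,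
    crossCov_add_right hC hv hf, crossCov_map_right he hf, crossCov_filtErr S he,
    crossCov_filtErr S hv, crossCov_sens_left S (S.isInputLinear_kalmanErr φ σ s),
    crossCov_sens_right S (S.isInputLinear_kalmanErr φ σ s), crossCov_sens S hsens, hP,
    kalmanGain]
  have hR := S.posDef_innovationCov hsens (σ s) (hP ▸ crossCov_self_posSemidef he)
  have hu : IsUnit (S.C (σ s) * S.errorCov σ φ s * (S.C (σ s)).transpose +
    S.sensCov (σ s)).det := (Matrix.isUnit_iff_isUnit_det _).1 hR.isUnit
  set P := S.errorCov σ φ s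
  set C := S.C (σ s)
  set V := S.sensCov (σ s)
  -- The normal equation of the gain, `G (C P Cᵀ + V) = P Cᵀ`, is exactly what makes the filtering
  -- error orthogonal to the innovation.
  have h1 : P * C.transpose * (C * P * C.transpose + V)⁻¹ * (C * P * C.transpose + V)
      = P * C.transpose := Matrix.nonsing_inv_mul_cancel_right _ _ hu
  rw [Matrix.mul_add] at h1
  generalize P * C.transpose * (C * P * C.transpose + V)⁻¹ = G at h1 ⊢
  simp only [Matrix.mul_assoc] at h1
  simp only [Matrix.mul_zero, Matrix.sub_mul, Matrix.mul_assoc, add_zero, zero_add, zero_sub]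
  rw [← sub_eq_add_neg, sub_sub, h1, sub_self]

/-- The conditional expectation is the Kalman filter, once the filtering error is uncorrelated
with the measurements. -/
lemma estimate_ae_eq (h : ∀ s ≤ t, crossCov (S.law φ)
      (fun ω => S.state t ω - S.kalmanFilt φ σ t ω) (S.meas σ s) = 0) :
    S.estimate φ σ t =ᵐ[S.law φ] S.kalmanFilt φ σ t := by
  have hf : IsInputLinear Set.univ (fun ω => S.state t ω - S.kalmanFilt φ σ t ω) :=
    ((S.isInputLinear_state t).mono (Set.subset_univ _)).sub
      ((S.isInputLinear_kalmanFilt φ σ t).mono (Set.subset_univ _))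
  have hfilt : Integrable (S.kalmanFilt φ σ t) (S.law φ) :=
    ((S.isInputLinear_kalmanFilt φ σ t).memLp S).integrable (by norm_num)
  have hfi : Integrable (fun ω => S.state t ω - S.kalmanFilt φ σ t ω) (S.law φ) :=
    (hf.memLp S).integrable (by norm_num)
  have hmeas : Measurable fun ω => S.state t ω - S.kalmanFilt φ σ t ω :=
    (S.measurable_state t).sub ((S.measurable_kalmanFilt φ σ t).mono (S.measSigma_le σ t) le_rfl)
  have hind : IndepFun (fun ω => S.state t ω - S.kalmanFilt φ σ t ω)
      (fun ω (s : Fin (t + 1)) => S.meas σ s ω) (S.law φ) :=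
    hf.indepFun S (fun s => (S.isInputLinear_meas σ s).mono (Set.subset_univ _))
      fun s => h s (Nat.lt_succ_iff.1 s.2)
  -- The filtering error is independent of the measurements and centred, so its conditional
  -- expectation vanishes.
  have h0 : (S.law φ)[fun ω => S.state t ω - S.kalmanFilt φ σ t ω | S.measSigma σ t]
      =ᵐ[S.law φ] fun _ => 0 := by
    have := condExp_indep_eq hmeas.comap_le (S.measSigma_le σ t)
      (comap_measurable _).stronglyMeasurable hind
    rwa [hf.integral_eq_zero S] at this
  have hsum : S.state t = (fun ω => S.state t ω - S.kalmanFilt φ σ t ω) + S.kalmanFilt φ σ t := by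
    ext1 ω
    simp
  have h1 := condExp_add hfi hfilt (S.measSigma σ t)
  rw [← hsum, condExp_of_stronglyMeasurable (S.measSigma_le σ t)
    (S.measurable_kalmanFilt φ σ t).stronglyMeasurable hfilt] at h1
  filter_upwards [h0, h1] with ω h0 h1
  rw [estimate, h1, Pi.add_apply, h0, zero_add]

lemma errorCov_eq_crossCov (t : ℕ) : S.errorCov σ φ t =
    crossCov (S.law φ) (S.predError φ σ t) (S.predError φ σ t) := rfl

/-- The prediction error is that of the Kalman filter, and is uncorrelated with the earlier
measurements. -/
lemma predError_ae_eq (hsens : ∀ i, (S.sensCov i).PosDef) (t : ℕ) :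
    S.predError φ σ t =ᵐ[S.law φ] S.kalmanErr φ σ t ∧
      ∀ s < t, crossCov (S.law φ) (S.kalmanErr φ σ t) (S.meas σ s) = 0 := by
  induction t with
  | zero =>
    refine ⟨Eventually.of_forall fun ω => ?_, by simp⟩
    simp [predError, kalmanErr, kalmanPred]
  | succ t ih =>
    obtain ⟨h1, h2⟩ := ih
    -- The gain is built from the true `errorCov`; the induction hypothesis identifies this with the
    -- covariance of `kalmanErr`, so there is no circularity.
    have horth := S.crossCov_filtErr_meas hsens (S.errorCov_eq_crossCov t ▸
      crossCov_congr h1.symm h1.symm) h2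
    have hf : MemLp (fun ω => S.state t ω - S.kalmanFilt φ σ t ω) 2 (S.law φ) :=
      (((S.isInputLinear_state t).mono (inputsBefore_mono t.le_succ)).sub
        (S.isInputLinear_kalmanFilt φ σ t)).memLp S
    refine ⟨?_, fun s hs => ?_⟩
    · filter_upwards [S.estimate_ae_eq horth] with ω h
      rw [predError, h, kalmanErr, kalmanPred, kalmanFilt]
    · have hm : MemLp (S.meas σ s) 2 (S.law φ) := (S.isInputLinear_meas σ s).memLp S
      have hnot : InputIndex.proc t ∉ inputsBefore M s ∪ {InputIndex.sens (σ s) s} := by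
        rintro (h | h)
        · exact absurd (show t < s from h) (by lia)
        · exact absurd (Set.mem_singleton_iff.1
            (show InputIndex.proc t ∈ ({.sens (σ s) s} : Set _) from h)) (by simp)
      rw [funext fun ω => S.kalmanErr_succ φ σ t ω,
        crossCov_add_left (memLp_toEuclideanLin hf _) (S.memLp_proc t) hm,
        crossCov_map_left hf hm, horth s (Nat.lt_succ_iff.1 hs),
        crossCov_proc_left S hnot (S.isInputLinear_meas_union σ s), Matrix.mul_zero, add_zero]

/-- The covariance of the prediction error evolves by the gain update with the Kalman gain. -/
lemma errorCov_succ (hproc : S.procCov.PosDef) (hsens : ∀ i, (S.sensCov i).PosDef) (t : ℕ) :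
    S.errorCov σ φ (t + 1) =
      S.gainUpdate (σ t) (S.A * S.kalmanGain φ σ t) (S.errorCov σ φ t) := by
  have he : MemLp (S.kalmanErr φ σ t) 2 (S.law φ) := (S.isInputLinear_kalmanErr φ σ t).memLp S
  have hP : crossCov (S.law φ) (S.kalmanErr φ σ t) (S.kalmanErr φ σ t) = S.errorCov σ φ t :=
    crossCov_congr (S.predError_ae_eq hsens t).1.symm (S.predError_ae_eq hsens t).1.symm
  have hv := S.memLp_sens (φ := φ) (σ t) t
  have hw := S.memLp_proc (φ := φ) t
  have hf : MemLp (fun ω => S.state t ω - S.kalmanFilt φ σ t ω) 2 (S.law φ) :=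
    (((S.isInputLinear_state t).mono (inputsBefore_mono t.le_succ)).sub
      (S.isInputLinear_kalmanFilt φ σ t)).memLp S
  have hAf := memLp_toEuclideanLin hf S.A
  have hAfw : MemLp (fun ω => Matrix.toEuclideanLin S.A (S.state t ω - S.kalmanFilt φ σ t ω) +
    (ω (.proc t) : EuclideanSpace ℝ (Fin n))) 2 (S.law φ) := hAf.add hw
  have hvw : crossCov (S.law φ) (fun ω => (ω (.sens (σ t) t) : EuclideanSpace ℝ (Fin p)))
      (fun ω => (ω (.proc t) : EuclideanSpace ℝ (Fin n))) = 0 :=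
    IsInputLinear.crossCov_eq_zero S (s := {.sens (σ t) t}) (t := {.proc t})
      (by simp) (isInputLinear_input (k := .sens (σ t) t) rfl)
      (isInputLinear_input (k := .proc t) rfl)
  have hew : crossCov (S.law φ) (S.kalmanErr φ σ t)
      (fun ω => (ω (.proc t) : EuclideanSpace ℝ (Fin n))) = 0 :=
    IsInputLinear.crossCov_eq_zero S (disjoint_inputsBefore_proc t)
      (S.isInputLinear_kalmanErr φ σ t) (isInputLinear_input (k := .proc t) rfl)
  have hfw : crossCov (S.law φ) (fun ω => S.state t ω - S.kalmanFilt φ σ t ω)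
      (fun ω => (ω (.proc t) : EuclideanSpace ℝ (Fin n))) = 0 := by
    rw [crossCov_filtErr S hw, hew, hvw]
    simp
  have hwf : crossCov (S.law φ) (fun ω => (ω (.proc t) : EuclideanSpace ℝ (Fin n)))
      (fun ω => S.state t ω - S.kalmanFilt φ σ t ω) = 0 := by
    rw [← crossCov_transpose, hfw, Matrix.transpose_zero]
  have hPt : (S.errorCov σ φ t).transpose = S.errorCov σ φ t := by
    rw [← hP, crossCov_transpose]
  have hVt : (S.sensCov (σ t)).transpose = S.sensCov (σ t) := by
    rw [← crossCov_sens (φ := φ) S hsens (σ t) t, crossCov_transpose]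
  have hef : crossCov (S.law φ) (S.kalmanErr φ σ t)
      (fun ω => S.state t ω - S.kalmanFilt φ σ t ω) = S.errorCov σ φ t -
        S.errorCov σ φ t * (S.C (σ t)).transpose * (S.kalmanGain φ σ t).transpose := by
    rw [← crossCov_transpose, crossCov_filtErr S he, hP,
      crossCov_sens_left S (S.isInputLinear_kalmanErr φ σ t)]
    simp [hPt]
  have hvf : crossCov (S.law φ) (fun ω => (ω (.sens (σ t) t) : EuclideanSpace ℝ (Fin p)))
      (fun ω => S.state t ω - S.kalmanFilt φ σ t ω) =
        - (S.sensCov (σ t) * (S.kalmanGain φ σ t).transpose) := by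
    rw [← crossCov_transpose, crossCov_filtErr S hv,
      crossCov_sens_right S (S.isInputLinear_kalmanErr φ σ t), crossCov_sens S hsens]
    simp [hVt]
  rw [errorCov_eq_crossCov, crossCov_congr (S.predError_ae_eq hsens (t + 1)).1
    (S.predError_ae_eq hsens (t + 1)).1, funext fun ω => S.kalmanErr_succ φ σ t ω,
    crossCov_add_left hAf hw hAfw, crossCov_add_right hAf hw hAf, crossCov_add_right hAf hw hw,
    crossCov_map_left hf hAf, crossCov_map_right hf hf, crossCov_map_left hf hw, hfw,
    crossCov_map_right hf hw, crossCov_proc S hproc, hwf,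
    crossCov_filtErr S hf, hef, hvf, gainUpdate]
  simp only [Matrix.transpose_mul, Matrix.transpose_sub, Matrix.mul_sub, Matrix.sub_mul,
    Matrix.mul_add, Matrix.mul_neg, Matrix.add_mul, Matrix.neg_mul, Matrix.mul_assoc,
    Matrix.mul_zero, Matrix.zero_mul]
  abel

lemma errorCov_posSemidef (hsens : ∀ i, (S.sensCov i).PosDef) (t : ℕ) :
    (S.errorCov σ φ t).PosSemidef := by
  have he : MemLp (S.kalmanErr φ σ t) 2 (S.law φ) := (S.isInputLinear_kalmanErr φ σ t).memLp S
  rw [errorCov_eq_crossCov, crossCov_congr (S.predError_ae_eq hsens t).1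
    (S.predError_ae_eq hsens t).1]
  exact crossCov_self_posSemidef he

/-- Completion of the square: the gain update is minimized by the Kalman gain. -/
lemma gainUpdate_sub {i : Fin M} {P : Matrix (Fin n) (Fin n) ℝ} (hP : P.transpose = P)
    (hV : (S.sensCov i).transpose = S.sensCov i) {K₀ : Matrix (Fin n) (Fin p) ℝ}
    (hK₀ : K₀ * (S.C i * P * (S.C i).transpose + S.sensCov i) = S.A * P * (S.C i).transpose)
    (K : Matrix (Fin n) (Fin p) ℝ) :
    S.gainUpdate i K P - S.gainUpdate i K₀ P =
      (K - K₀) * (S.C i * P * (S.C i).transpose + S.sensCov i) * (K - K₀).transpose := by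
  -- Expand as a quadratic polynomial in the gain; `hK₀` then replaces the linear coefficient.
  have h1 : ∀ K : Matrix (Fin n) (Fin p) ℝ, S.gainUpdate i K P = S.A * P * S.A.transpose
      + S.procCov - K * (S.A * P * (S.C i).transpose).transpose
      - S.A * P * (S.C i).transpose * K.transpose
      + K * (S.C i * P * (S.C i).transpose + S.sensCov i) * K.transpose := by
    intro K
    simp only [gainUpdate, Matrix.transpose_mul, Matrix.transpose_sub, Matrix.mul_sub,
      Matrix.sub_mul, Matrix.mul_add, Matrix.add_mul, Matrix.mul_assoc,
      Matrix.transpose_transpose, hP]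
    abel
  have hR : (S.C i * P * (S.C i).transpose + S.sensCov i).transpose =
      S.C i * P * (S.C i).transpose + S.sensCov i := by
    simp [Matrix.transpose_mul, hP, hV, Matrix.mul_assoc]
  rw [h1 K, h1 K₀, ← hK₀]
  rw [Matrix.transpose_mul, hR]
  generalize S.C i * P * (S.C i).transpose + S.sensCov i = R
  simp only [Matrix.transpose_sub, Matrix.mul_sub, Matrix.sub_mul, Matrix.mul_assoc]
  abel

/-- By `gainUpdate_sub` the difference is a congruence of the positive definite innovation
covariance. This lets one schedule be bounded using gains borrowed from another. -/
lemma errorCov_succ_le (hproc : S.procCov.PosDef) (hsens : ∀ i, (S.sensCov i).PosDef) (t : ℕ)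
    (K : Matrix (Fin n) (Fin p) ℝ) :
    (S.gainUpdate (σ t) K (S.errorCov σ φ t) - S.errorCov σ φ (t + 1)).PosSemidef := by
  have hP := S.errorCov_posSemidef (φ := φ) (σ := σ) hsens t
  have hR := S.posDef_innovationCov hsens (σ t) hP
  rw [S.errorCov_succ hproc hsens, S.gainUpdate_sub]
  · simpa only [Matrix.conjTranspose_eq_transpose_of_trivial] using
      hR.posSemidef.mul_mul_conjTranspose_same (K - S.A * S.kalmanGain φ σ t)
  · simpa only [Matrix.conjTranspose_eq_transpose_of_trivial] using hP.isHermitian.eq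
  · simpa only [Matrix.conjTranspose_eq_transpose_of_trivial] using (hsens (σ t)).isHermitian.eq
  · rw [kalmanGain, ← Matrix.mul_assoc, Matrix.nonsing_inv_mul_cancel_right _ _
      ((Matrix.isUnit_iff_isUnit_det _).1 hR.isUnit), Matrix.mul_assoc]

end Moments

end System

end Kalman

/-! ### Comparison of covariance trajectories in the Loewner order -/

section Comparison

open scoped MatrixOrder

variable {n p M : ℕ}

lemma exists_le_smul_one {X : Matrix (Fin n) (Fin n) ℝ} (hX : IsSelfAdjoint X) :
    ∃ a : ℝ, 0 ≤ a ∧ X ≤ a • (1 : Matrix (Fin n) (Fin n) ℝ) := by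
  obtain ⟨a, ha⟩ := (Matrix.finite_real_spectrum (A := X)).bddAbove
  refine ⟨max a 0, le_max_right _ _, ?_⟩
  rw [← Algebra.algebraMap_eq_smul_one]
  exact le_algebraMap_of_spectrum_le (fun x hx => (ha hx).trans (le_max_left _ _)) hX

lemma exists_one_le_smul {W : Matrix (Fin n) (Fin n) ℝ} (hW : W.PosDef) :
    ∃ d : ℝ, 0 < d ∧ (1 : Matrix (Fin n) (Fin n) ℝ) ≤ d • W := by
  rcases subsingleton_or_nontrivial (Matrix (Fin n) (Fin n) ℝ) with _ | _
  · exact ⟨1, one_pos, (Subsingleton.elim _ _).le⟩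
  have hW' := Matrix.isStrictlyPositive_iff_posDef.2 hW
  obtain ⟨r, hr, hle⟩ := (CFC.exists_pos_algebraMap_le_iff hW'.isSelfAdjoint).2
    fun x hx => hW'.spectrum_pos hx
  refine ⟨r⁻¹, inv_pos.2 hr, ?_⟩
  have := smul_le_smul_of_nonneg_left hle (inv_nonneg.2 hr.le)
  rwa [Algebra.algebraMap_eq_smul_one, smul_smul, inv_mul_cancel₀ hr.ne', one_smul] at this

lemma mul_mul_transpose_mono {m : ℕ} {X Y : Matrix (Fin n) (Fin n) ℝ} (h : X ≤ Y)
    (B : Matrix (Fin m) (Fin n) ℝ) : B * X * B.transpose ≤ B * Y * B.transpose := by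
  rw [Matrix.le_iff] at h ⊢
  rw [← Matrix.sub_mul, ← Matrix.mul_sub, ← Matrix.conjTranspose_eq_transpose_of_trivial]
  exact h.mul_mul_conjTranspose_same B

lemma trace_mono {X Y : Matrix (Fin n) (Fin n) ℝ} (h : X ≤ Y) : X.trace ≤ Y.trace := by
  have := (Matrix.le_iff.1 h).trace_nonneg
  rw [Matrix.trace_sub] at this
  linarith

namespace System

variable (S : System n p M)

lemma gainUpdate_eq_add (i : Fin M) (K : Matrix (Fin n) (Fin p) ℝ)
    (P : Matrix (Fin n) (Fin n) ℝ) :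
    S.gainUpdate i K P = (S.A - K * S.C i) * P * (S.A - K * S.C i).transpose
      + (S.procCov + K * S.sensCov i * K.transpose) := by
  rw [gainUpdate, add_assoc]

lemma procCov_le_add (hsens : ∀ i, (S.sensCov i).PosDef) (i : Fin M)
    (K : Matrix (Fin n) (Fin p) ℝ) : S.procCov ≤ S.procCov + K * S.sensCov i * K.transpose := by
  have := (hsens i).posSemidef.mul_mul_conjTranspose_same K
  rw [Matrix.conjTranspose_eq_transpose_of_trivial, ← Matrix.nonneg_iff_posSemidef] at this
  exact le_add_of_nonneg_right this

lemma procCov_le_gainUpdate (hsens : ∀ i, (S.sensCov i).PosDef) (i : Fin M)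
    (K : Matrix (Fin n) (Fin p) ℝ) {P : Matrix (Fin n) (Fin n) ℝ} (hP : 0 ≤ P) :
    S.procCov ≤ S.gainUpdate i K P := by
  have := mul_mul_transpose_mono hP (S.A - K * S.C i)
  rw [Matrix.mul_zero, Matrix.zero_mul] at this
  rw [gainUpdate_eq_add]
  exact (S.procCov_le_add hsens i K).trans (le_add_of_nonneg_left this)

lemma gainUpdate_mono (i : Fin M) (K : Matrix (Fin n) (Fin p) ℝ)
    {P Q : Matrix (Fin n) (Fin n) ℝ} (h : P ≤ Q) : S.gainUpdate i K P ≤ S.gainUpdate i K Q := by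
  rw [gainUpdate_eq_add, gainUpdate_eq_add]
  exact add_le_add_left (mul_mul_transpose_mono h _) _

/-- A relative excess of the covariance is contracted by the gain update. -/
lemma gainUpdate_le_of_le_smul (hsens : ∀ i, (S.sensCov i).PosDef) (i : Fin M)
    (K : Matrix (Fin n) (Fin p) ℝ) {P Q : Matrix (Fin n) (Fin n) ℝ} {s η : ℝ} (hs : 0 ≤ s)
    (hQ : Q ≤ (1 + s) • P) (hη : (1 - η) • S.gainUpdate i K P ≤ S.procCov) :
    S.gainUpdate i K Q ≤ (1 + s * η) • S.gainUpdate i K P := by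
  refine (S.gainUpdate_mono i K hQ).trans ?_
  -- Scaling `P` does not scale the noise term, and this deficit is the source of the contraction.
  have h1 : S.gainUpdate i K ((1 + s) • P) = (1 + s) • S.gainUpdate i K P -
      s • (S.procCov + K * S.sensCov i * K.transpose) := by
    simp only [gainUpdate_eq_add, Matrix.mul_smul, Matrix.smul_mul]
    module
  have h2 : s • ((1 - η) • S.gainUpdate i K P) ≤
      s • (S.procCov + K * S.sensCov i * K.transpose) :=
    smul_le_smul_of_nonneg_left (hη.trans (S.procCov_le_add hsens i K)) hs
  rw [h1]
  calc (1 + s) • S.gainUpdate i K P - s • (S.procCov + K * S.sensCov i * K.transpose)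
      ≤ (1 + s) • S.gainUpdate i K P - s • ((1 - η) • S.gainUpdate i K P) :=
        sub_le_sub_left h2 _
    _ = (1 + s * η) • S.gainUpdate i K P := by module

/-- After one gain update, a bounded covariance is comparable with any other covariance. -/
lemma gainUpdate_le_of_le_smul_one (hsens : ∀ i, (S.sensCov i).PosDef) (i : Fin M)
    (K : Matrix (Fin n) (Fin p) ℝ) {P Q : Matrix (Fin n) (Fin n) ℝ} {a b : ℝ} (hP : 0 ≤ P)
    (ha : 0 ≤ a) (hb : 0 ≤ b) (hQ : Q ≤ b • (1 : Matrix (Fin n) (Fin n) ℝ))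
    (hK : (S.A - K * S.C i) * (S.A - K * S.C i).transpose ≤ a • S.procCov) :
    S.gainUpdate i K Q ≤ (1 + b * a) • S.gainUpdate i K P := by
  have hP' := mul_mul_transpose_mono hP (S.A - K * S.C i)
  rw [Matrix.mul_zero, Matrix.zero_mul] at hP'
  have hW : (b * a) • S.procCov ≤ (b * a) • S.gainUpdate i K P :=
    smul_le_smul_of_nonneg_left (S.procCov_le_gainUpdate hsens i K hP) (mul_nonneg hb ha)
  have h1 : (S.A - K * S.C i) * Q * (S.A - K * S.C i).transpose ≤ (b * a) • S.procCov := by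
    refine (mul_mul_transpose_mono hQ _).trans ?_
    rw [Matrix.mul_smul, Matrix.smul_mul, Matrix.mul_one, mul_smul]
    exact smul_le_smul_of_nonneg_left hK hb
  rw [add_smul, one_smul, add_comm (S.gainUpdate i K P), gainUpdate_eq_add S i K Q]
  refine add_le_add (h1.trans hW) ?_
  rw [gainUpdate_eq_add]
  exact le_add_of_nonneg_left hP'

/-- Two trajectories under the same sensors, the first driven by its own gains `K`, approach each
other exponentially fast. -/
lemma trajectory_le (hsens : ∀ i, (S.sensCov i).PosDef) {σ : Schedule M}
    {K : ℕ → Matrix (Fin n) (Fin p) ℝ} {P Q : ℕ → Matrix (Fin n) (Fin n) ℝ} {a b η : ℝ} {N : ℕ}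
    (hP0 : 0 ≤ P 0) (hP : ∀ t, P (t + 1) = S.gainUpdate (σ t) (K t) (P t))
    (hη0 : 0 ≤ η) (hη : ∀ t, (1 - η) • P t ≤ S.procCov)
    (ha : 0 ≤ a) (hb : 0 ≤ b)
    (hK : (S.A - K 0 * S.C (σ 0)) * (S.A - K 0 * S.C (σ 0)).transpose ≤ a • S.procCov)
    (hQ0 : Q 0 ≤ b • (1 : Matrix (Fin n) (Fin n) ℝ))
    (hQ : ∀ t < N, Q (t + 1) ≤ S.gainUpdate (σ t) (K t) (Q t)) :
    ∀ j < N, Q (j + 1) ≤ (1 + b * a * η ^ j) • P (j + 1) := by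
  intro j
  induction j with
  | zero =>
    intro h
    rw [pow_zero, mul_one, hP]
    exact (hQ 0 h).trans (S.gainUpdate_le_of_le_smul_one hsens _ _ hP0 ha hb hQ0 hK)
  | succ j ih =>
    intro h
    rw [hP (j + 1), pow_succ, ← mul_assoc]
    exact (hQ _ h).trans (S.gainUpdate_le_of_le_smul hsens _ _
      (mul_nonneg (mul_nonneg hb ha) (pow_nonneg hη0 _)) (ih (by lia)) (hP (j + 1) ▸ hη (j + 2)))

end System

end Comparison

/-! ### Periodic and geometric sums -/

section Averages

/-- A sum of values dominated by an `N`-periodic sequence is bounded by the sums over periods. -/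
lemma sum_range_le_of_le_periodic {f u : ℕ → ℝ} {N : ℕ} (hN : 0 < N) (hu : ∀ j < N, 0 ≤ u j)
    (hf : ∀ t, f t ≤ u (t % N)) (T : ℕ) :
    ∑ t ∈ Finset.range T, f t ≤ (T / N + 1 : ℝ) * ∑ j ∈ Finset.range N, u j := by
  have hblock : ∀ k : ℕ, ∑ t ∈ Finset.range (N * k), u (t % N) =
      k * ∑ j ∈ Finset.range N, u j := by
    intro k
    induction k with
    | zero => simp
    | succ k ih =>
      rw [Nat.mul_succ, Finset.sum_range_add, ih]
      have : ∑ x ∈ Finset.range N, u ((N * k + x) % N) = ∑ j ∈ Finset.range N, u j :=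
        Finset.sum_congr rfl fun x hx => by
          rw [Nat.mul_add_mod, Nat.mod_eq_of_lt (Finset.mem_range.1 hx)]
      rw [this]
      push_cast
      ring
  have hU : 0 ≤ ∑ j ∈ Finset.range N, u j :=
    Finset.sum_nonneg fun j hj => hu j (Finset.mem_range.1 hj)
  calc ∑ t ∈ Finset.range T, f t ≤ ∑ t ∈ Finset.range T, u (t % N) :=
        Finset.sum_le_sum fun t _ => hf t
    -- Complete the last, possibly partial, period; the added terms are nonnegative.
    _ ≤ ∑ t ∈ Finset.range (N * (T / N + 1)), u (t % N) :=
        Finset.sum_le_sum_of_subset_of_nonneg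
          (Finset.range_subset_range.2 (Nat.lt_mul_div_succ T hN).le)
          fun t _ _ => hu _ (Nat.mod_lt _ hN)
    _ = ((T / N : ℕ) + 1 : ℝ) * ∑ j ∈ Finset.range N, u j := by
        rw [hblock]
        push_cast
        ring
    _ ≤ _ := mul_le_mul_of_nonneg_right (by gcongr; exact Nat.cast_div_le) hU

lemma sum_range_pow_le {η : ℝ} (h0 : 0 ≤ η) (h1 : η < 1) (N : ℕ) :
    ∑ j ∈ Finset.range N, η ^ j ≤ (1 - η)⁻¹ := by
  rw [← tsum_geometric_of_lt_one h0 h1]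
  exact (summable_geometric_of_lt_one h0 h1).sum_le_tsum _ fun i _ => pow_nonneg h0 i

end Averages

/-! ### Costs of feasible schedules and of their periodic repetitions -/

section Cost

open scoped MatrixOrder

variable {n p M : ℕ} (S : System n p M) {φ : Matrix (Fin n) (Fin n) ℝ} {σ : Schedule M}

namespace System

lemma avgCost_eq (N : ℕ) : S.avgCost σ φ N =
    (∑ t ∈ Finset.range N, (S.errorCov σ φ (t + 1)).trace) / N := by
  rw [avgCost, Finset.range_eq_Ico, Finset.sum_Ico_add' (fun t => (S.errorCov σ φ t).trace) 0 N 1,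
    zero_add, Finset.Ico_add_one_right_eq_Icc]
  ring

lemma avgCost_nonneg (hsens : ∀ i, (S.sensCov i).PosDef) (N : ℕ) : 0 ≤ S.avgCost σ φ N := by
  rw [avgCost_eq]
  exact div_nonneg (Finset.sum_nonneg fun t _ =>
    (S.errorCov_posSemidef hsens (t + 1)).trace_nonneg) N.cast_nonneg

lemma avgCost_le_of_errorCov_le {β : ℝ} (hβ : 0 ≤ β)
    (h : ∀ t, S.errorCov σ φ t ≤ β • (1 : Matrix (Fin n) (Fin n) ℝ)) (N : ℕ) :
    S.avgCost σ φ N ≤ β * n := by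
  rw [avgCost_eq]
  refine div_le_of_le_mul₀ N.cast_nonneg (by positivity) ?_
  calc ∑ t ∈ Finset.range N, (S.errorCov σ φ (t + 1)).trace
      ≤ ∑ t ∈ Finset.range N, β * n := Finset.sum_le_sum fun t _ => by
        simpa [Matrix.trace_smul] using trace_mono (h (t + 1))
    _ = β * n * N := by simp [mul_comm]

/-- Enlarging the bound makes it strictly positive, so that it can be inverted later. -/
lemma exists_bound_of_feasible (hσ : σ ∈ S.feasible φ) : ∃ β : ℝ, 0 < β ∧
    ∀ t, S.errorCov σ φ t ≤ β • (1 : Matrix (Fin n) (Fin n) ℝ) := by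
  obtain ⟨β, hβ⟩ := hσ
  refine ⟨max β 1, lt_max_of_lt_right one_pos, fun t => (Matrix.le_iff.2 (hβ t)).trans ?_⟩
  exact smul_le_smul_of_nonneg_right (le_max_left _ _)
    (Matrix.nonneg_iff_posSemidef.2 Matrix.PosSemidef.one)

lemma isBoundedUnder_avgCost (hσ : σ ∈ S.feasible φ) :
    IsBoundedUnder (· ≤ ·) atTop fun N => S.avgCost σ φ N := by
  obtain ⟨β, hβ, h⟩ := S.exists_bound_of_feasible hσ
  exact isBoundedUnder_of ⟨β * n, S.avgCost_le_of_errorCov_le hβ.le h⟩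

lemma infCost_nonneg (hsens : ∀ i, (S.sensCov i).PosDef) (hσ : σ ∈ S.feasible φ) :
    0 ≤ S.infCost σ φ :=
  le_limsup_of_frequently_le (Frequently.of_forall fun N => S.avgCost_nonneg hsens N)
    (S.isBoundedUnder_avgCost hσ)

lemma optCost_le_infCost (hsens : ∀ i, (S.sensCov i).PosDef) (hσ : σ ∈ S.feasible φ) :
    S.optCost φ ≤ S.infCost σ φ :=
  csInf_le ⟨0, by rintro _ ⟨τ, hτ, rfl⟩; exact S.infCost_nonneg hsens hτ⟩ ⟨σ, hσ, rfl⟩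

/-- Under a schedule whose trace sequence is dominated by an `N`-periodic sequence, the
infinite-horizon cost is at most the mean of that sequence over a period. -/
lemma infCost_le_of_le_periodic (hsens : ∀ i, (S.sensCov i).PosDef) {u : ℕ → ℝ} {N : ℕ}
    (hN : 0 < N) (hu : ∀ j < N, 0 ≤ u j)
    (h : ∀ t, (S.errorCov σ φ (t + 1)).trace ≤ u (t % N)) :
    S.infCost σ φ ≤ (∑ j ∈ Finset.range N, u j) / N := by
  set U := ∑ j ∈ Finset.range N, u j
  have hlim : Tendsto (fun T : ℕ => U / N + U / T) atTop (𝓝 (U / N)) := by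
    simpa using tendsto_const_nhds.add (tendsto_const_div_atTop_nhds_zero_nat U)
  rw [← hlim.limsup_eq]
  refine limsup_le_limsup ?_ (isCoboundedUnder_le_of_le _ fun N => S.avgCost_nonneg hsens N)
    hlim.isBoundedUnder_le
  filter_upwards [eventually_gt_atTop 0] with T hT
  have hT' : (0 : ℝ) < T := Nat.cast_pos.2 hT
  rw [avgCost_eq, div_le_iff₀ hT']
  refine (sum_range_le_of_le_periodic hN hu h T).trans_eq ?_
  change (T / N + 1) * U = (U / N + U / T) * T
  field_simp

/-- Repeating the first `N` decisions of a feasible schedule periodically gives, for large `N`,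
a feasible schedule with infinite-horizon cost at most the `N`-horizon cost up to `O(1/N)`. -/
theorem exists_optCost_le_avgCost (hproc : S.procCov.PosDef)
    (hsens : ∀ i, (S.sensCov i).PosDef) (hσ : σ ∈ S.feasible φ) :
    ∃ c : ℝ, ∀ᶠ N : ℕ in atTop, S.optCost φ - c / N ≤ S.avgCost σ φ N := by
  obtain ⟨β, hβ, hle⟩ := S.exists_bound_of_feasible hσ
  obtain ⟨d, hd, hdW⟩ := exists_one_le_smul hproc
  set K : ℕ → Matrix (Fin n) (Fin p) ℝ := fun t => S.A * S.kalmanGain φ σ t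
  set P : ℕ → Matrix (Fin n) (Fin n) ℝ := S.errorCov σ φ
  have hP : ∀ t, P (t + 1) = S.gainUpdate (σ t) (K t) (P t) := S.errorCov_succ hproc hsens
  have hPnn : ∀ t, 0 ≤ P t := fun t =>
    Matrix.nonneg_iff_posSemidef.2 (S.errorCov_posSemidef hsens t)
  have hone : (0 : Matrix (Fin n) (Fin n) ℝ) ≤ 1 :=
    Matrix.nonneg_iff_posSemidef.2 Matrix.PosSemidef.one
  -- From `P t ≤ β • 1 ≤ (β * d) • procCov`, any `δ ≤ 1 / (β * d)` gives `δ • P t ≤ procCov`; the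
  -- cap `1 / 2` keeps `η = 1 - δ` nonnegative.
  set δ : ℝ := min (1 / 2) (1 / (β * d))
  have hδ0 : 0 < δ := by positivity
  have hδ1 : δ ≤ 1 / 2 := min_le_left _ _
  set η : ℝ := 1 - δ
  have hη0 : 0 ≤ η := by simp only [η]; linarith
  have hη1 : η < 1 := by simp only [η]; linarith
  have hη : ∀ t, (1 - η) • P t ≤ S.procCov := fun t => by
    have h1 : (1 - η) • P t ≤ (1 / (β * d)) • P t :=
      smul_le_smul_of_nonneg_right (by simp [η, δ]) (hPnn t)
    have h2 : (1 / (β * d)) • P t ≤ (1 / (β * d)) • β • d • S.procCov :=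
      smul_le_smul_of_nonneg_left ((hle t).trans (smul_le_smul_of_nonneg_left hdW hβ.le))
        (by positivity)
    refine (h1.trans h2).trans_eq ?_
    rw [smul_smul, smul_smul, show 1 / (β * d) * β * d = 1 by field_simp, one_smul]
  obtain ⟨a', ha', hK'⟩ := exists_le_smul_one
    (X := (S.A - K 0 * S.C (σ 0)) * (S.A - K 0 * S.C (σ 0)).transpose)
    (by
      have := (Matrix.posSemidef_self_mul_conjTranspose (S.A - K 0 * S.C (σ 0))).isHermitian
      rwa [Matrix.conjTranspose_eq_transpose_of_trivial] at this)
  set a : ℝ := a' * d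
  have ha : 0 ≤ a := by positivity
  have hK : (S.A - K 0 * S.C (σ 0)) * (S.A - K 0 * S.C (σ 0)).transpose ≤ a • S.procCov := by
    refine hK'.trans ?_
    rw [mul_smul]
    exact smul_le_smul_of_nonneg_left hdW ha'
  -- The factor `2` makes the start bound self-reproducing: a relative excess of at most `1` over `P
  -- N ≤ β • 1` returns below `b • 1`.
  set b : ℝ := 2 * β
  have hb : 0 ≤ b := by positivity
  have hsmall : ∀ᶠ N : ℕ in atTop, b * a * η ^ N ≤ 1 := by
    have : Tendsto (fun N : ℕ => b * a * η ^ N) atTop (𝓝 (b * a * 0)) :=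
      (tendsto_pow_atTop_nhds_zero_of_lt_one hη0 hη1).const_mul _
    rw [mul_zero] at this
    exact this.eventually_le_const one_pos
  -- The constant bounds the total excess trace over one period: relative excess `b * a * η ^ j`,
  -- times the trace bound `β * n`, summed geometrically.
  refine ⟨b * a * (β * n) * (1 - η)⁻¹, ?_⟩
  -- The shift by one is needed because the excess at the end of a period carries the power `η ^ (N
  -- - 1)`.
  filter_upwards [(tendsto_sub_atTop_nat 1).eventually hsmall, eventually_gt_atTop 0]
    with N hNsmall hN
  set τ : Schedule M := fun t => σ (t % N)
  set Q : ℕ → Matrix (Fin n) (Fin n) ℝ := S.errorCov τ φ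
  have hQ : ∀ t K, Q (t + 1) ≤ S.gainUpdate (τ t) K (Q t) := fun t K =>
    Matrix.le_iff.2 (S.errorCov_succ_le hproc hsens t K)
  -- Within each period `τ` uses the first `N` sensors of `σ`, so the gains of `σ` can be reused
  -- from its time `0`.
  have hseg : ∀ k, Q (N * k) ≤ b • (1 : Matrix (Fin n) (Fin n) ℝ) →
      ∀ j < N, Q (N * k + j + 1) ≤ (1 + b * a * η ^ j) • P (j + 1) := fun k hk =>
    S.trajectory_le (Q := fun j => Q (N * k + j)) hsens (hPnn 0) hP hη0 hη ha hb hK hk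
      fun t ht => by
        have h := hQ (N * k + t) (K t)
        simpa only [τ, Nat.mul_add_mod, Nat.mod_eq_of_lt ht, add_assoc] using h
  have hstart : ∀ k, Q (N * k) ≤ b • (1 : Matrix (Fin n) (Fin n) ℝ) := by
    intro k
    induction k with
    | zero =>
      exact (hle 0).trans (smul_le_smul_of_nonneg_right (by simp only [b]; linarith) hone)
    | succ k ih =>
      have h := hseg k ih (N - 1) (by lia)
      rw [show N * k + (N - 1) + 1 = N * (k + 1) by rw [Nat.mul_succ]; lia] at h
      calc Q (N * (k + 1)) ≤ (1 + b * a * η ^ (N - 1)) • P (N - 1 + 1) := h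
        _ ≤ (2 : ℝ) • P (N - 1 + 1) := smul_le_smul_of_nonneg_right (by linarith) (hPnn _)
        _ ≤ (2 : ℝ) • β • (1 : Matrix (Fin n) (Fin n) ℝ) :=
          smul_le_smul_of_nonneg_left (hle _) zero_le_two
        _ = b • 1 := smul_smul _ _ _
  have hdom : ∀ t, Q (t + 1) ≤ (1 + b * a * η ^ (t % N)) • P (t % N + 1) := fun t => by
    have h := hseg (t / N) (hstart _) (t % N) (Nat.mod_lt _ hN)
    rwa [Nat.div_add_mod] at h
  have hτ : τ ∈ S.feasible φ := by
    refine ⟨(1 + b * a) * β, fun t => Matrix.le_iff.1 ?_⟩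
    rcases t with _ | t
    · refine (hle 0).trans (smul_le_smul_of_nonneg_right ?_ hone)
      exact le_mul_of_one_le_left hβ.le (le_add_of_nonneg_right (by positivity))
    · refine (hdom t).trans ?_
      rw [mul_smul]
      refine (smul_le_smul_of_nonneg_left (hle _) (by positivity)).trans
        (smul_le_smul_of_nonneg_right ?_ (smul_nonneg hβ.le hone))
      exact add_le_add_right (mul_le_of_le_one_right (by positivity) (pow_le_one₀ hη0 hη1.le)) _
  have hu : ∀ j, 0 ≤ (1 + b * a * η ^ j) * (P (j + 1)).trace := fun j =>
    mul_nonneg (by positivity) (S.errorCov_posSemidef hsens _).trace_nonneg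
  have hcost := S.infCost_le_of_le_periodic (σ := τ) (φ := φ) hsens
    (u := fun j => (1 + b * a * η ^ j) * (P (j + 1)).trace) hN (fun j _ => hu j) fun t => by
      have := trace_mono (hdom t)
      rwa [Matrix.trace_smul, smul_eq_mul] at this
  have hN' : (0 : ℝ) < N := Nat.cast_pos.2 hN
  rw [sub_le_iff_le_add, avgCost_eq, ← add_div]
  refine (S.optCost_le_infCost hsens hτ).trans (hcost.trans ?_)
  refine div_le_div_of_nonneg_right ?_ hN'.le
  simp only [add_mul, one_mul, Finset.sum_add_distrib]
  refine add_le_add_right ?_ _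
  calc ∑ j ∈ Finset.range N, b * a * η ^ j * (P (j + 1)).trace
      ≤ ∑ j ∈ Finset.range N, b * a * (β * n) * η ^ j := Finset.sum_le_sum fun j _ => by
        have h : (P (j + 1)).trace ≤ β * n := by
          simpa [Matrix.trace_smul] using trace_mono (hle (j + 1))
        calc b * a * η ^ j * (P (j + 1)).trace ≤ b * a * η ^ j * (β * n) := by gcongr
          _ = _ := by ring
    _ ≤ b * a * (β * n) * (1 - η)⁻¹ := by
        rw [← Finset.mul_sum]
        exact mul_le_mul_of_nonneg_left (sum_range_pow_le hη0 hη1 N) (by positivity)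

end System

end Cost

end SensorScheduling

end

theorem mainTheorem2 {n p M : ℕ} (S : SensorScheduling.System n p M)
    (hproc : S.procCov.PosDef) (hsens : ∀ i, (S.sensCov i).PosDef)
    (hfeas : ∀ φ : Matrix (Fin n) (Fin n) ℝ, φ.PosSemidef → (S.feasible φ).Nonempty)
    (φ₀ : Matrix (Fin n) (Fin n) ℝ) (hφ₀ : φ₀.PosSemidef)
    (σ : SensorScheduling.Schedule M) (hσ : S.IsOptimal σ φ₀) :
    Tendsto (fun N : ℕ => S.avgCost σ φ₀ N) atTop (𝓝 (S.optCost φ₀)) := by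
  obtain ⟨c, hc⟩ := S.exists_optCost_le_avgCost hproc hsens hσ.1
  have hlim : Tendsto (fun N : ℕ => S.optCost φ₀ - c / N) atTop (𝓝 (S.optCost φ₀)) := by
    simpa using tendsto_const_nhds.sub (tendsto_const_div_atTop_nhds_zero_nat c)
  have hbdd := S.isBoundedUnder_avgCost hσ.1
  -- Optimality supplies the limsup bound; the liminf bound follows from `hc`.
  refine tendsto_of_le_liminf_of_limsup_le ?_ hσ.2.le hbdd
    (isBoundedUnder_of ⟨0, fun N => S.avgCost_nonneg hsens N⟩)
  rw [← hlim.liminf_eq]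
  exact liminf_le_liminf hc hlim.isBoundedUnder_ge hbdd.isCoboundedUnder_ge
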